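/- For an integer $n\ge 2$, a $4$-graph $\mathcal F$ on $[n]=\{1,\dots,n\}$ is a family of $4$-element subsets (edges) of $[n]$. Its Lagrangian is $$\lambda(\mathcal F)=\max\Big\{\sum_{e\in\mathcal F}\ \prod_{i\in e}x_i \;:\; x\in\mathbb R^n,\ x_i\ge 0 \text{ for all } i\in[n],\ \sum_{i=1}^n x_i=1\Big\}.$$ Let $M_2^4$ denote the $4$-graph consisting of two disjoint edges, so that $\mathcal F$ is $M_2^4$-free (contains no copy of $M_2^4$ as a subgraph) if and only if no two edges of $\mathcal F$ are disjoint. For $v\in[n]$, the star with centre $v$ is the $4$-graph on $[n]$ whose edges are all $4$-subsets of $[n]$ containing $v$. **Theorem 1.3.** Let $n\ge 2$ and let $\mathcal F$ be an $M_2^4$-free $4$-graph on $[n]$. If $\mathcal F$ is not contained in a star (with any centre $v\in[n]$), then $$\lambda(\mathcal F)<0.0169<\frac{9}{512}.$$ Otherwise, that is, if $\mathcal F$ is contained in the star with centre $v$ for some $v\in[n]$, then $$\lambda(\mathcal F)\le\frac{9(n-2)(n-3)}{512(n-1)^2}.$$ -/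

import Mathlib

/-- An `r`-uniform hypergraph (an `r`-graph) with vertex set `V`: a finite family of `r`-element
subsets of `V`. -/
@[ext]
structure RGraph (r : ℕ) (V : Type*) where
  /-- The edge set. -/
  edges : Finset (Finset V)
  /-- Every edge has exactly `r` vertices. -/
  uniform : ∀ e ∈ edges, e.card = r

namespace RGraph

/-- `F` is a subgraph of `G`, for `r`-graphs with the same vertex set. -/
def IsSubgraph {r : ℕ} {V : Type*} (F G : RGraph r V) : Prop :=
  F.edges ⊆ G.edges

/-- `G` contains a copy of `F`: some injection of the vertices of `F` into those of `G` sends every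
edge of `F` to an edge of `G`. -/
def ContainsCopy {r : ℕ} {V W : Type*} (F : RGraph r V) (G : RGraph r W) : Prop :=
  ∃ f : V ↪ W, ∀ e ∈ F.edges, e.map f ∈ G.edges

/-- `G` is `F`-free if it does not contain a copy of `F`. -/
def Free {r : ℕ} {V W : Type*} (F : RGraph r V) (G : RGraph r W) : Prop :=
  ¬ F.ContainsCopy G

/-- The `r`-uniform `t`-matching `M_t^r`: the vertices are the pairs `(i, j)` with `i < t`, `j < r`,
and the `t` pairwise disjoint edges are the rows `{(i, j) : j < r}`. -/
def matching (t r : ℕ) : RGraph r (Fin t × Fin r) where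
  edges := Finset.univ.image fun i : Fin t => {i} ×ˢ (Finset.univ : Finset (Fin r))
  uniform := by
    intro e he
    obtain ⟨i, -, rfl⟩ := Finset.mem_image.1 he
    simp

/-- The star with centre `v`: the edges are all `r`-subsets of `V` that contain `v`. -/
def star (r : ℕ) {V : Type*} [Fintype V] [DecidableEq V] (v : V) : RGraph r V where
  edges := (Finset.powersetCard r Finset.univ).filter fun e => v ∈ e
  uniform := by
    intro e he
    exact (Finset.mem_powersetCard.1 (Finset.mem_filter.1 he).1).2

/-- The Lagrangian function `λ(G, x) = ∑_{e ∈ E(G)} ∏_{i ∈ e} x_i`. -/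
def lagrangianFun {r : ℕ} {V : Type*} (G : RGraph r V) (x : V → ℝ) : ℝ :=
  ∑ e ∈ G.edges, ∏ i ∈ e, x i

/-- The Lagrangian `λ(G)`: the maximum of `λ(G, x)` over the weightings `x ≥ 0` with total weight
`1`. It is attained whenever there is a vertex, see `isGreatest_lagrangian`. -/
noncomputable def lagrangian {r : ℕ} {V : Type*} [Fintype V] (G : RGraph r V) : ℝ :=
  sSup (G.lagrangianFun '' stdSimplex ℝ V)

/-- The supremum in the definition of the Lagrangian is a maximum. -/
theorem isGreatest_lagrangian {r : ℕ} {V : Type*} [Fintype V] [Nonempty V] (G : RGraph r V) :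
    IsGreatest (G.lagrangianFun '' stdSimplex ℝ V) G.lagrangian := by
  classical
  have hc : Continuous G.lagrangianFun := by
    unfold lagrangianFun
    fun_prop
  have hne : (stdSimplex ℝ V).Nonempty := ⟨_, single_mem_stdSimplex ℝ (Classical.arbitrary V)⟩
  exact ((isCompact_stdSimplex ℝ V).image hc).isGreatest_sSup (hne.image _)

end RGraph

/-!
A family is `M_2^4`-free exactly when its edges pairwise meet, so the theorem bounds the Lagrangian
of an intersecting family of `4`-sets.

*Stars.* If all edges contain `v`, the value at `x` is at most `x v` times the third elementary
symmetric polynomial of the other weights. Maclaurin's inequality (`esymm_le_choose_mul_pow`) and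
the maximum `27 / 256` of `a (1 - a) ^ 3` give the bound.

*Other families.* Fix a weighting and order the vertices by decreasing weight. The `(i, j)`-shift
with `i` before `j` replaces `j` by `i` in the edges where it can; it keeps the family
intersecting and does not decrease its value. Shift as long as the family does not become a star.

* If the next shift would produce a star (`of_shift_star`), its centre is `i`. Then every edge meets
  `{i, j}`, and the link `A` of `i` (among the edges avoiding `j`) and the link `B` of `j` (among
  the edges avoiding `i`) are disjoint `3`-graphs. With `a ≥ b` the weights of `i` and `j` and
  `c = 1 - a - b`, disjointness gives `A + B ≤ c³ / 6`. As all edges of `A` meet a fixed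
  triple, namely an edge of `B`, also `A ≤ 0.11 c³`.
* If the family is shifted and has an edge avoiding the vertices `0` and `1`, it contains all
  `4`-subsets of the first six vertices, so that each edge has three vertices among those six and
  the value is at most `35 / 2401` (`weight_le_of_three_le_card_inter`).
* If the family is shifted and all edges meet `{0, 1}`, then either each edge in `A` and `B` has two
  vertices in `{2, 3, 4, 5}`, and `A, B ≤ 0.08 c³`; or `B` is a star with centre `2`, and
  `A ≤ 0.11 c³`, `B ≤ 0.08 c³`.

Whenever all edges meet a pair, the value is at most `a b c² / 2 + a A + b B`, and in each case
this is at most `a b c² / 2 + (0.11 a + 0.08 b) c³ < 0.0169` (`pair_cover_numeric`). No property of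
an optimal weighting is needed.
-/

namespace IntersectingLagrangian

open Finset

/-! ### Elementary symmetric polynomials and Maclaurin's inequality -/

variable {α : Type*}

/-- The value at the weighting `x` of the Lagrangian function of the set family `F`. -/
def weight (F : Finset (Finset α)) (x : α → ℝ) : ℝ := ∑ e ∈ F, ∏ i ∈ e, x i

/-- The `k`-th elementary symmetric polynomial of the weights of the vertices in `S`. -/
def esymm (k : ℕ) (S : Finset α) (x : α → ℝ) : ℝ := weight (S.powersetCard k) x

theorem weight_mono {x : α → ℝ} (hx : ∀ i, 0 ≤ x i) {F G : Finset (Finset α)} (h : F ⊆ G) :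
    weight F x ≤ weight G x :=
  sum_le_sum_of_subset_of_nonneg h fun _ _ _ => prod_nonneg fun i _ => hx i

@[simp] theorem esymm_zero (S : Finset α) (x : α → ℝ) : esymm 0 S x = 1 := by
  simp [esymm, weight]

@[simp] theorem esymm_one (S : Finset α) (x : α → ℝ) : esymm 1 S x = ∑ i ∈ S, x i := by
  simp [esymm, weight, powersetCard_one]

theorem esymm_succ_empty (k : ℕ) (x : α → ℝ) : esymm (k + 1) ∅ x = 0 := by
  rw [esymm, powersetCard_eq_empty.2 (by simp), weight, sum_empty]

theorem esymm_succ_insert [DecidableEq α] {v : α} {S : Finset α} (hv : v ∉ S) (k : ℕ)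
    (x : α → ℝ) : esymm (k + 1) (insert v S) x = esymm (k + 1) S x + x v * esymm k S x := by
  have hmem : ∀ e ∈ S.powersetCard k, v ∉ e := fun e he h => hv ((mem_powersetCard.1 he).1 h)
  rw [esymm, weight, powersetCard_succ_insert hv, sum_union, sum_image, esymm, esymm, weight,
    weight, mul_sum]
  · congr 1
    exact sum_congr rfl fun e he => prod_insert (hmem e he)
  · intro e he f hf h
    rw [← erase_insert (hmem e he), ← erase_insert (hmem f hf), h]
  · rw [disjoint_left]
    intro e he h
    obtain ⟨f, -, rfl⟩ := mem_image.1 h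
    exact hv ((mem_powersetCard.1 he).1 (mem_insert_self _ _))

/-- The tangent line of `w ↦ w ^ (k + 1)` at `u` lies below the graph (Bernoulli's inequality,
homogenized). -/
theorem pow_mul_tangent_le {u w : ℝ} (hu : 0 ≤ u) (hw : 0 ≤ w) (k : ℕ) :
    u ^ k * ((k + 1) * w - k * u) ≤ w ^ (k + 1) := by
  induction k with
  | zero => simp
  | succ k ih =>
    have h1 := mul_le_mul_of_nonneg_right ih hw
    have h2 : 0 ≤ (k + 1) * (u ^ k * (w - u) ^ 2) := by positivity
    push_cast
    calc u ^ (k + 1) * ((k + 1 + 1) * w - (k + 1) * u)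
        = u ^ k * ((k + 1) * w - k * u) * w - (k + 1) * (u ^ k * (w - u) ^ 2) := by ring
      _ ≤ w ^ (k + 1 + 1) := by rw [pow_succ w (k + 1)]; linarith

/-- Maclaurin's inequality between an elementary symmetric polynomial and the mean. Adding a
variable to a set with mean `u` moves the mean to `w`, and the required inequality is that
`w ↦ w ^ k` lies above its tangent at `u`. -/
theorem esymm_le_choose_mul_pow {x : α → ℝ} (hx : ∀ i, 0 ≤ x i) (k : ℕ) (S : Finset α) :
    esymm k S x ≤ (#S).choose k * ((∑ i ∈ S, x i) / #S) ^ k := by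
  classical
  induction S using Finset.induction_on generalizing k with
  | empty =>
    cases k with
    | zero => simp
    | succ k => simp [esymm_succ_empty]
  | insert v S hv ih =>
    cases k with
    | zero => simp
    | succ k =>
      rw [esymm_succ_insert hv, card_insert_of_notMem hv, sum_insert hv]
      have hs : 0 ≤ ∑ i ∈ S, x i := sum_nonneg fun i _ => hx i
      have hy := hx v
      have hu : (#S : ℝ) * ((∑ i ∈ S, x i) / #S) = ∑ i ∈ S, x i := by
        rcases S.eq_empty_or_nonempty with rfl | h
        · simp
        · have : (#S : ℝ) ≠ 0 := by exact_mod_cast h.card_pos.ne'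
          field_simp
      have hu0 : 0 ≤ (∑ i ∈ S, x i) / #S := by positivity
      have hw : ((#S : ℝ) + 1) * ((x v + ∑ i ∈ S, x i) / ((#S + 1 : ℕ) : ℝ))
          = x v + ∑ i ∈ S, x i := by
        push_cast
        field_simp
      have hw0 : 0 ≤ (x v + ∑ i ∈ S, x i) / ((#S + 1 : ℕ) : ℝ) := by positivity
      have h1 := ih (k + 1)
      have h2 := mul_le_mul_of_nonneg_left (ih k) hy
      have h3 := pow_mul_tangent_le hu0 hw0 k
      set u := (∑ i ∈ S, x i) / #S
      set w := (x v + ∑ i ∈ S, x i) / ((#S + 1 : ℕ) : ℝ)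
      have hc : ((#S : ℝ) + 1) * (#S).choose k
          = ((#S).choose k + (#S).choose (k + 1)) * (k + 1) := by
        have := Nat.add_one_mul_choose_eq #S k
        rw [Nat.choose_succ_succ] at this
        exact_mod_cast this
      have h4 := mul_le_mul_of_nonneg_left h3
        (by positivity : (0 : ℝ) ≤ (#S).choose k + (#S).choose (k + 1))
      have hxv : x v = (#S + 1) * w - #S * u := by linarith
      rw [Nat.choose_succ_succ, Nat.cast_add]
      calc _ ≤ _ := add_le_add h1 h2
        _ = (((#S).choose k : ℝ) + (#S).choose (k + 1)) * (u ^ k * ((k + 1) * w - k * u)) := by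
          rw [hxv]
          linear_combination (w - u) * u ^ k * hc
        _ ≤ _ := h4

theorem esymm_le_pow_div_factorial {x : α → ℝ} (hx : ∀ i, 0 ≤ x i) (k : ℕ) (S : Finset α) :
    esymm k S x ≤ (∑ i ∈ S, x i) ^ k / k.factorial := by
  have hs : 0 ≤ ∑ i ∈ S, x i := sum_nonneg fun i _ => hx i
  rcases S.eq_empty_or_nonempty with rfl | h
  · cases k with
    | zero => simp
    | succ k => simp [esymm_succ_empty]
  · refine (esymm_le_choose_mul_pow hx k S).trans ?_
    have h0 : (0 : ℝ) < #S := by exact_mod_cast h.card_pos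
    calc _ ≤ (#S : ℝ) ^ k / k.factorial * ((∑ i ∈ S, x i) / #S) ^ k := by
          gcongr
          exact Nat.choose_le_pow_div k #S
      _ = _ := by
          rw [div_pow]
          field_simp

theorem esymm_le_choose_mul_pow_of_card_eq {x : α → ℝ} (hx : ∀ i, 0 ≤ x i) (k : ℕ) {S : Finset α}
    {m : ℕ} (hm : #S = m) : esymm k S x ≤ m.choose k * ((∑ i ∈ S, x i) / m) ^ k :=
  hm ▸ esymm_le_choose_mul_pow hx k S

/-- If the number of vertices that an edge of the `k`-graph `F` has in `T` always lies in `J`, the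
weight of `F` is at most that of all `k`-sets with this property. -/
theorem weight_le_sum_esymm_mul_esymm [DecidableEq α] {x : α → ℝ} (hx : ∀ i, 0 ≤ x i)
    {F : Finset (Finset α)} {U : Finset α} (T : Finset α) {k : ℕ} (J : Finset ℕ)
    (hU : ∀ e ∈ F, e ⊆ U) (hk : ∀ e ∈ F, #e = k) (hJ : ∀ e ∈ F, #(e ∩ T) ∈ J) :
    weight F x ≤ ∑ j ∈ J, esymm j T x * esymm (k - j) (U \ T) x := by
  rw [weight, ← sum_fiberwise_of_maps_to hJ]
  refine sum_le_sum fun j _ => ?_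
  have hinj : Set.InjOn (fun e => (e ∩ T, e \ T)) (F.filter fun e => #(e ∩ T) = j) := by
    intro e _ f _ h
    simp only [Prod.mk.injEq] at h
    rw [← sdiff_union_inter e T, ← sdiff_union_inter f T, h.1, h.2]
  calc ∑ e ∈ F with #(e ∩ T) = j, ∏ i ∈ e, x i
      = ∑ p ∈ (F.filter fun e => #(e ∩ T) = j).image fun e => (e ∩ T, e \ T),
          (∏ i ∈ p.1, x i) * ∏ i ∈ p.2, x i := by
        rw [sum_image hinj]
        exact sum_congr rfl fun e _ => (prod_inter_mul_prod_sdiff e T x).symm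
    _ ≤ ∑ p ∈ T.powersetCard j ×ˢ (U \ T).powersetCard (k - j),
          (∏ i ∈ p.1, x i) * ∏ i ∈ p.2, x i := by
        refine sum_le_sum_of_subset_of_nonneg ?_ fun p _ _ =>
          mul_nonneg (prod_nonneg fun i _ => hx i) (prod_nonneg fun i _ => hx i)
        intro p hp
        obtain ⟨e, he, rfl⟩ := mem_image.1 hp
        rw [mem_filter] at he
        have h1 := card_sdiff_add_card_inter e T
        have h2 := hk e he.1
        simp only [mem_product, mem_powersetCard]
        exact ⟨⟨inter_subset_right, he.2⟩, sdiff_subset_sdiff (hU e he.1) subset_rfl, by omega⟩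
    _ = _ := by rw [sum_product, esymm, esymm, weight, weight, sum_mul_sum]

/-! ### Families with prescribed intersections with a small set -/

section Bounds

variable {x : α → ℝ} {F : Finset (Finset α)} {U T : Finset α}

theorem weight_le_of_forall_card_eq_three (hx : ∀ i, 0 ≤ x i) (hU : ∀ e ∈ F, e ⊆ U)
    (hk : ∀ e ∈ F, #e = 3) : weight F x ≤ (∑ i ∈ U, x i) ^ 3 / 6 := by
  have h : weight F x ≤ esymm 3 U x :=
    weight_mono hx fun e he => mem_powersetCard.2 ⟨hU e he, hk e he⟩
  have h2 := esymm_le_pow_div_factorial hx 3 U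
  norm_num [Nat.factorial] at h2
  linarith

variable [DecidableEq α]

/-- The maximum of `t r² / 2` over `t + r = c` is `2 c³ / 27`, attained at `r = 2 t`. -/
theorem weight_le_of_forall_mem {v : α} (hx : ∀ i, 0 ≤ x i) (hU : ∀ e ∈ F, e ⊆ U)
    (hk : ∀ e ∈ F, #e = 3) (hvU : v ∈ U) (hv : ∀ e ∈ F, v ∈ e) :
    weight F x ≤ 0.08 * (∑ i ∈ U, x i) ^ 3 := by
  have h := weight_le_sum_esymm_mul_esymm hx (U := U) {v} {1} hU hk fun e he => by
    simp [inter_singleton_of_mem (hv e he)]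
  have h2 := esymm_le_pow_div_factorial hx 2 (U \ {v})
  have hsum := sum_sdiff (f := x) (singleton_subset_iff.2 hvU)
  have hr : 0 ≤ ∑ i ∈ U \ {v}, x i := sum_nonneg fun i _ => hx i
  have hv0 := hx v
  simp only [sum_singleton, esymm_one, Nat.reduceSub] at h hsum
  norm_num [Nat.factorial] at h2
  rw [← hsum]
  set r := ∑ i ∈ U \ {v}, x i
  have h3 := mul_le_mul_of_nonneg_left h2 hv0
  nlinarith [mul_nonneg hr (sq_nonneg (r - 2 * x v)), mul_nonneg hv0 (sq_nonneg (r - 2 * x v)),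
    mul_nonneg hv0 hv0, pow_nonneg hr 3, pow_nonneg hv0 3, mul_nonneg (sq_nonneg (x v)) hr,
    mul_nonneg (sq_nonneg r) hv0]

theorem weight_le_of_meets_triple (hx : ∀ i, 0 ≤ x i) (hU : ∀ e ∈ F, e ⊆ U)
    (hk : ∀ e ∈ F, #e = 3) (hTU : T ⊆ U) (hT : #T = 3) (hF : ∀ e ∈ F, (e ∩ T).Nonempty) :
    weight F x ≤ 0.11 * (∑ i ∈ U, x i) ^ 3 := by
  have h := weight_le_sum_esymm_mul_esymm hx (U := U) T {1, 2, 3} hU hk fun e he => by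
    have h1 := (hF e he).card_pos
    have h2 := card_le_card (inter_subset_right (s₁ := e) (s₂ := T))
    simp only [mem_insert, mem_singleton]
    omega
  have hsum := sum_sdiff (f := x) hTU
  have hr : 0 ≤ ∑ i ∈ U \ T, x i := sum_nonneg fun i _ => hx i
  have ht : 0 ≤ ∑ i ∈ T, x i := sum_nonneg fun i _ => hx i
  have h2 := esymm_le_pow_div_factorial hx 2 (U \ T)
  have h3 := esymm_le_choose_mul_pow_of_card_eq hx 2 hT
  have h4 := esymm_le_choose_mul_pow_of_card_eq hx 3 hT
  simp [sum_insert] at h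
  norm_num [Nat.factorial, Nat.choose] at h2 h3 h4
  rw [← hsum]
  set r := ∑ i ∈ U \ T, x i
  set t := ∑ i ∈ T, x i
  have h5 := mul_le_mul_of_nonneg_left h2 ht
  have h6 := mul_le_mul_of_nonneg_right h3 hr
  -- With `t + r = 1` the bound is attained near `t = 0.48`.
  nlinarith [mul_nonneg hr (sq_nonneg (13 * t - 12 * r)),
    mul_nonneg ht (sq_nonneg (13 * t - 12 * r)),
    pow_nonneg hr 3, pow_nonneg ht 3, mul_nonneg (sq_nonneg t) hr,
    mul_nonneg (sq_nonneg r) ht]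

theorem weight_le_of_two_le_card_inter (hx : ∀ i, 0 ≤ x i) (hU : ∀ e ∈ F, e ⊆ U)
    (hk : ∀ e ∈ F, #e = 3) (hTU : T ⊆ U) (hT : #T = 4) (hF : ∀ e ∈ F, 2 ≤ #(e ∩ T)) :
    weight F x ≤ 0.08 * (∑ i ∈ U, x i) ^ 3 := by
  have h := weight_le_sum_esymm_mul_esymm hx (U := U) T {2, 3} hU hk fun e he => by
    have h1 := hF e he
    have h2 := card_le_card (inter_subset_left (s₁ := e) (s₂ := T))
    have h3 := hk e he
    simp only [mem_insert, mem_singleton]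
    omega
  have hsum := sum_sdiff (f := x) hTU
  have hr : 0 ≤ ∑ i ∈ U \ T, x i := sum_nonneg fun i _ => hx i
  have ht : 0 ≤ ∑ i ∈ T, x i := sum_nonneg fun i _ => hx i
  have h3 := esymm_le_choose_mul_pow_of_card_eq hx 2 hT
  have h4 := esymm_le_choose_mul_pow_of_card_eq hx 3 hT
  simp [sum_insert] at h
  norm_num [Nat.choose] at h3 h4
  rw [← hsum]
  set r := ∑ i ∈ U \ T, x i
  set t := ∑ i ∈ T, x i
  have h6 := mul_le_mul_of_nonneg_right h3 hr
  -- Equality holds at `t = 4 r`.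
  nlinarith [mul_nonneg hr (sq_nonneg (t - 4 * r)), mul_nonneg ht (sq_nonneg (t - 4 * r)),
    pow_nonneg hr 3, pow_nonneg ht 3]

/-- The bound `35 / 2401` is the Lagrangian of the complete `4`-graph on seven vertices. -/
theorem weight_le_of_three_le_card_inter (hx : ∀ i, 0 ≤ x i) (hU : ∀ e ∈ F, e ⊆ U)
    (hsumU : ∑ i ∈ U, x i = 1)
    (hk : ∀ e ∈ F, #e = 4) (hTU : T ⊆ U) (hT : #T = 6) (hF : ∀ e ∈ F, 3 ≤ #(e ∩ T)) :
    weight F x ≤ 35 / 2401 := by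
  have h := weight_le_sum_esymm_mul_esymm hx (U := U) T {3, 4} hU hk fun e he => by
    have h1 := hF e he
    have h2 := card_le_card (inter_subset_left (s₁ := e) (s₂ := T))
    have h3 := hk e he
    simp only [mem_insert, mem_singleton]
    omega
  have hsum := sum_sdiff (f := x) hTU
  have hr : 0 ≤ ∑ i ∈ U \ T, x i := sum_nonneg fun i _ => hx i
  have ht : 0 ≤ ∑ i ∈ T, x i := sum_nonneg fun i _ => hx i
  have h3 := esymm_le_choose_mul_pow_of_card_eq hx 3 hT
  have h4 := esymm_le_choose_mul_pow_of_card_eq hx 4 hT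
  simp [sum_insert] at h
  norm_num [Nat.choose] at h3 h4
  rw [hsumU] at hsum
  set r := ∑ i ∈ U \ T, x i
  set t := ∑ i ∈ T, x i
  have h6 := mul_le_mul_of_nonneg_right h3 hr
  have hrt : r = 1 - t := by linarith
  rw [hrt] at h6 h
  -- Equality holds at `t = 6 / 7`, where the quartic in `t` has a double root.
  have h7 : 0 ≤ (7 * t - 6) ^ 2 * (t ^ 2 + (4 / 7) * t + 12 / 49) := by positivity
  nlinarith [h7]

end Bounds

/-- The numerical inequality behind every family with a cover of size two. In `u = a + b` and
`d = a - b` the left side is a concave quadratic in `d`; its maximum over `d` is a quartic in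
`c = 1 - u`. -/
theorem pair_cover_numeric {a b c : ℝ} (h : a + b + c = 1) (ha : 0 ≤ a) (hb : 0 ≤ b)
    (hc : 0 ≤ c) :
    a * b * (c ^ 2 / 2) + (0.11 * a + 0.08 * b) * c ^ 3 < 0.0169 := by
  have h1 : 0 ≤ c ^ 2 * (a - b - 0.06 * c) ^ 2 := by positivity
  have h2 : a * b * (c ^ 2 / 2) + (0.11 * a + 0.08 * b) * c ^ 3
      ≤ c ^ 2 * (0.125 - 0.155 * c + 0.03045 * c ^ 2) := by
    obtain rfl : b = 1 - c - a := by linarith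
    nlinarith [h1]
  have h3 : c ^ 2 * (0.125 - 0.155 * c + 0.03045 * c ^ 2) < 0.0169 := by
    have h4 : 0 ≤ 1 - c := by linarith
    nlinarith [mul_nonneg (mul_nonneg hc h4) (sq_nonneg (c - 0.65)), sq_nonneg (c - 0.65),
      mul_nonneg hc (sq_nonneg (c - 0.65))]
  linarith

/-! ### Families whose edges meet a pair of vertices -/

section PairCover

variable [DecidableEq α]

/-- The link of `i` in `F`, restricted to the edges that avoid `j`. -/
def linkAvoiding (i j : α) (F : Finset (Finset α)) : Finset (Finset α) :=
  (F.filter fun e => i ∈ e ∧ j ∉ e).image fun e => e.erase i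

theorem mem_linkAvoiding {i j : α} (hij : i ≠ j) {F : Finset (Finset α)} {e : Finset α} :
    e ∈ linkAvoiding i j F ↔ i ∉ e ∧ j ∉ e ∧ insert i e ∈ F := by
  simp only [linkAvoiding, mem_image, mem_filter]
  constructor
  · rintro ⟨f, ⟨hf, hi, hj⟩, rfl⟩
    exact ⟨notMem_erase _ _, fun h => hj (mem_of_mem_erase h), by rwa [insert_erase hi]⟩
  · rintro ⟨hi, hj, he⟩
    exact ⟨insert i e, ⟨he, mem_insert_self _ _, by simp [hij.symm, hj]⟩, erase_insert hi⟩

theorem subset_of_mem_linkAvoiding {i j : α} (hij : i ≠ j) {F : Finset (Finset α)}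
    {U : Finset α} (hU : ∀ e ∈ F, e ⊆ U) : ∀ e ∈ linkAvoiding i j F, e ⊆ U \ {i, j} := by
  intro e he v hv
  rw [mem_linkAvoiding hij] at he
  have := hU _ he.2.2 (mem_insert_of_mem hv)
  simp only [mem_sdiff, mem_insert, mem_singleton, not_or]
  exact ⟨this, fun h => he.1 (h ▸ hv), fun h => he.2.1 (h ▸ hv)⟩

theorem card_of_mem_linkAvoiding {i j : α} (hij : i ≠ j) {F : Finset (Finset α)} {k : ℕ}
    (hk : ∀ e ∈ F, #e = k + 1) : ∀ e ∈ linkAvoiding i j F, #e = k := by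
  intro e he
  rw [mem_linkAvoiding hij] at he
  have := hk _ he.2.2
  rw [card_insert_of_notMem he.1] at this
  omega

theorem sum_filter_eq_mul_weight_linkAvoiding (i j : α) (F : Finset (Finset α)) (x : α → ℝ) :
    ∑ e ∈ F with i ∈ e ∧ j ∉ e, ∏ v ∈ e, x v = x i * weight (linkAvoiding i j F) x := by
  rw [weight, linkAvoiding, sum_image, mul_sum]
  · exact sum_congr rfl fun e he => (mul_prod_erase e x (mem_filter.1 he).2.1).symm
  · intro e he f hf (h : e.erase i = f.erase i)
    rw [← insert_erase (mem_filter.1 he).2.1, ← insert_erase (mem_filter.1 hf).2.1, h]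

theorem weight_le_of_pair_cover {x : α → ℝ} (hx : ∀ i, 0 ≤ x i) {F : Finset (Finset α)}
    {U : Finset α} (hU : ∀ e ∈ F, e ⊆ U) (hk : ∀ e ∈ F, #e = 4) {i j : α} (hij : i ≠ j)
    (hcov : ∀ e ∈ F, i ∈ e ∨ j ∈ e) :
    weight F x ≤ x i * x j * ((∑ v ∈ U \ {i, j}, x v) ^ 2 / 2)
      + (x i * weight (linkAvoiding i j F) x + x j * weight (linkAvoiding j i F) x) := by
  have hsplit : weight F x = weight (F.filter fun e => i ∈ e ∧ j ∈ e) x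
      + (∑ e ∈ F with i ∈ e ∧ j ∉ e, ∏ v ∈ e, x v
        + ∑ e ∈ F with j ∈ e ∧ i ∉ e, ∏ v ∈ e, x v) := by
    simp only [weight, sum_filter, ← sum_add_distrib]
    refine sum_congr rfl fun e he => ?_
    rcases hcov e he with h | h <;> by_cases h' : i ∈ e <;> by_cases h'' : j ∈ e <;> simp_all
  have hboth : weight (F.filter fun e => i ∈ e ∧ j ∈ e) x
      ≤ x i * x j * ((∑ v ∈ U \ {i, j}, x v) ^ 2 / 2) := by
    have h := weight_le_sum_esymm_mul_esymm hx (F := F.filter fun e => i ∈ e ∧ j ∈ e) (U := U)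
      {i, j} {2} (fun e he => hU e (mem_filter.1 he).1) (fun e he => hk e (mem_filter.1 he).1)
      fun e he => by
        have he := (mem_filter.1 he).2
        rw [inter_eq_right.2 (by simp [insert_subset_iff, he.1, he.2]), card_pair hij]
        simp
    have hpair : esymm 2 {i, j} x = x i * x j := by
      rw [esymm, ← card_pair hij, powersetCard_self, weight, sum_singleton, prod_pair hij]
    rw [sum_singleton, hpair] at h
    have h2 := esymm_le_pow_div_factorial hx 2 (U \ {i, j})
    norm_num [Nat.factorial] at h2
    exact h.trans (mul_le_mul_of_nonneg_left h2 (mul_nonneg (hx i) (hx j)))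
  rw [hsplit, sum_filter_eq_mul_weight_linkAvoiding, sum_filter_eq_mul_weight_linkAvoiding]
  linarith

theorem weight_lt_of_pair_cover {x : α → ℝ} (hx : ∀ i, 0 ≤ x i) {F : Finset (Finset α)}
    {U : Finset α} (hU : ∀ e ∈ F, e ⊆ U) (hsum : ∑ v ∈ U, x v = 1) (hk : ∀ e ∈ F, #e = 4)
    {i j : α} (hij : i ≠ j) (hi : i ∈ U) (hj : j ∈ U) (hcov : ∀ e ∈ F, i ∈ e ∨ j ∈ e)
    (hlink : x i * weight (linkAvoiding i j F) x + x j * weight (linkAvoiding j i F) x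
      ≤ (0.11 * x i + 0.08 * x j) * (∑ v ∈ U \ {i, j}, x v) ^ 3) :
    weight F x < 0.0169 := by
  have h := weight_le_of_pair_cover hx hU hk hij hcov
  have hs := sum_sdiff (f := x) (insert_subset hi (singleton_subset_iff.2 hj))
  rw [sum_pair hij, hsum] at hs
  have := pair_cover_numeric (a := x i) (b := x j) (c := ∑ v ∈ U \ {i, j}, x v) (by linarith)
    (hx i) (hx j) (sum_nonneg fun v _ => hx v)
  linarith

/-- If an edge `e` of `F` avoids `i`, then `e \ {j}` is a triple that meets every edge of the
link of `i`. -/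
theorem weight_linkAvoiding_le {x : α → ℝ} (hx : ∀ i, 0 ≤ x i) {F : Finset (Finset α)}
    {U : Finset α} (hU : ∀ e ∈ F, e ⊆ U) (hk : ∀ e ∈ F, #e = 4)
    (hF : ∀ e ∈ F, ∀ f ∈ F, (e ∩ f).Nonempty) {i j : α} (hij : i ≠ j)
    (hcov : ∀ e ∈ F, i ∈ e ∨ j ∈ e) (he : ∃ e ∈ F, i ∉ e) :
    weight (linkAvoiding i j F) x ≤ 0.11 * (∑ v ∈ U \ {i, j}, x v) ^ 3 := by
  obtain ⟨e, he, hie⟩ := he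
  have hje : j ∈ e := (hcov e he).resolve_left hie
  refine weight_le_of_meets_triple (T := e.erase j) hx (subset_of_mem_linkAvoiding hij hU)
    (card_of_mem_linkAvoiding hij hk) (fun v hv => ?_) (by simp [card_erase_of_mem hje, hk e he])
    fun f hf => ?_
  · simp only [mem_sdiff, mem_insert, mem_singleton, not_or]
    exact ⟨hU e he (mem_of_mem_erase hv), fun h => hie (h ▸ mem_of_mem_erase hv),
      ne_of_mem_erase hv⟩
  · rw [mem_linkAvoiding hij] at hf
    obtain ⟨v, hv⟩ := hF _ hf.2.2 e he
    simp only [mem_inter, mem_insert] at hv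
    have hvf : v ∈ f := hv.1.resolve_left fun h => hie (h ▸ hv.2)
    exact ⟨v, mem_inter.2 ⟨hvf, mem_erase.2 ⟨fun h => hf.2.1 (h ▸ hvf), hv.2⟩⟩⟩

/-- The bound for a family on the verge of becoming a star: its edges meet `{i, j}`, and no triple
is completed to an edge both by `i` and by `j`. -/
theorem weight_lt_of_disjoint_links {x : α → ℝ} (hx : ∀ i, 0 ≤ x i) {F : Finset (Finset α)}
    {U : Finset α} (hU : ∀ e ∈ F, e ⊆ U) (hsum : ∑ v ∈ U, x v = 1) (hk : ∀ e ∈ F, #e = 4)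
    (hF : ∀ e ∈ F, ∀ f ∈ F, (e ∩ f).Nonempty) {i j : α} (hij : i ≠ j) (hi : i ∈ U) (hj : j ∈ U)
    (hxij : x j ≤ x i) (hcov : ∀ e ∈ F, i ∈ e ∨ j ∈ e) (he : ∃ e ∈ F, i ∉ e)
    (hdisj : Disjoint (linkAvoiding i j F) (linkAvoiding j i F)) : weight F x < 0.0169 := by
  refine weight_lt_of_pair_cover hx hU hsum hk hij hi hj hcov ?_
  have hA := weight_linkAvoiding_le hx hU hk hF hij hcov he
  have hAB : weight (linkAvoiding i j F) x + weight (linkAvoiding j i F) x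
      ≤ (∑ v ∈ U \ {i, j}, x v) ^ 3 / 6 := by
    rw [weight, weight, ← sum_union hdisj]
    refine weight_le_of_forall_card_eq_three hx (fun e he => ?_) fun e he => ?_ <;>
      rcases mem_union.1 he with he | he
    · exact subset_of_mem_linkAvoiding hij hU e he
    · rw [pair_comm]
      exact subset_of_mem_linkAvoiding hij.symm hU e he
    · exact card_of_mem_linkAvoiding hij hk e he
    · exact card_of_mem_linkAvoiding hij.symm hk e he
  have hc : 0 ≤ (∑ v ∈ U \ {i, j}, x v) ^ 3 := pow_nonneg (sum_nonneg fun v _ => hx v) 3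
  -- `a A + b B = (a - b) A + b (A + B)` for `a = x i ≥ b = x j`
  nlinarith [mul_le_mul_of_nonneg_left hA (sub_nonneg.2 hxij),
    mul_le_mul_of_nonneg_left hAB (hx j), mul_nonneg (hx j) hc]

end PairCover

/-! ### Shifting -/

section Shift

variable [DecidableEq α]

/-- The image of the edge `e` under the `(i, j)`-shift of `F`: replace `j` by `i` if this is
possible and leads out of `F`. -/
def shiftEdge (i j : α) (F : Finset (Finset α)) (e : Finset α) : Finset α :=
  if j ∈ e ∧ i ∉ e ∧ insert i (e.erase j) ∉ F then insert i (e.erase j) else e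

/-- The `(i, j)`-shift of the family `F`, which moves edges from `j` to `i`. -/
def shift (i j : α) (F : Finset (Finset α)) : Finset (Finset α) := F.image (shiftEdge i j F)

/-- `F` is stable under the `(i, j)`-shift. -/
def IsShiftStable (i j : α) (F : Finset (Finset α)) : Prop :=
  ∀ e ∈ F, j ∈ e → i ∉ e → insert i (e.erase j) ∈ F

variable {i j : α} {F : Finset (Finset α)}

theorem shiftEdge_injOn : Set.InjOn (shiftEdge i j F) F := by
  have hinv : ∀ e : Finset α, j ∈ e → i ∉ e → insert j ((insert i (e.erase j)).erase i) = e :=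
    fun e hj hi => by
      rw [erase_insert fun h => hi (mem_of_mem_erase h), insert_erase hj]
  intro e he f hf h
  unfold shiftEdge at h
  split_ifs at h with h1 h2 h2
  · rw [← hinv e h1.1 h1.2.1, ← hinv f h2.1 h2.2.1, h]
  · exact absurd (h ▸ hf) h1.2.2
  · exact absurd (h ▸ he) h2.2.2
  · exact h

theorem card_shiftEdge (e : Finset α) : #(shiftEdge i j F e) = #e := by
  unfold shiftEdge
  split_ifs with h
  · rw [card_insert_of_notMem fun hi => h.2.1 (mem_of_mem_erase hi), card_erase_of_mem h.1]
    have := card_pos.2 ⟨j, h.1⟩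
    omega
  · rfl

theorem shiftEdge_subset {U e : Finset α} (hi : i ∈ U) (he : e ⊆ U) : shiftEdge i j F e ⊆ U := by
  unfold shiftEdge
  split_ifs
  · exact insert_subset hi ((erase_subset _ _).trans he)
  · exact he

theorem mem_shiftEdge_of_ne {e : Finset α} {v : α} (hi : v ≠ i) (hj : v ≠ j) :
    v ∈ shiftEdge i j F e ↔ v ∈ e := by
  unfold shiftEdge
  split_ifs <;> simp [hi, hj]

theorem weight_le_weight_shift {x : α → ℝ} (hx : ∀ i, 0 ≤ x i) (hij : x j ≤ x i) :
    weight F x ≤ weight (shift i j F) x := by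
  rw [weight, weight, shift, sum_image shiftEdge_injOn]
  refine sum_le_sum fun e _ => ?_
  unfold shiftEdge
  split_ifs with h
  · rw [prod_insert fun hi => h.2.1 (mem_of_mem_erase hi), ← mul_prod_erase e x h.1]
    exact mul_le_mul_of_nonneg_right hij (prod_nonneg fun v _ => hx v)
  · rfl

theorem shift_intersecting (hF : ∀ e ∈ F, ∀ f ∈ F, (e ∩ f).Nonempty) :
    ∀ e ∈ shift i j F, ∀ f ∈ shift i j F, (e ∩ f).Nonempty := by
  have hone : ∀ e ∈ F, ∀ f ∈ F, (j ∈ e ∧ i ∉ e ∧ insert i (e.erase j) ∉ F) →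
      ¬ (j ∈ f ∧ i ∉ f ∧ insert i (f.erase j) ∉ F) → (insert i (e.erase j) ∩ f).Nonempty := by
    intro e he f hf h1 h2
    by_cases hif : i ∈ f
    · exact ⟨i, by simp [hif]⟩
    by_cases hjf : j ∈ f
    · -- `f` stayed because its image was present already, and `e` meets that image.
      have hf' : insert i (f.erase j) ∈ F := by tauto
      obtain ⟨v, hv⟩ := hF e he _ hf'
      simp only [mem_inter, mem_insert, mem_erase] at hv
      have hvi : v ≠ i := fun h => h1.2.1 (h ▸ hv.1)
      exact ⟨v, by simp only [mem_inter, mem_insert, mem_erase]; tauto⟩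
    · obtain ⟨v, hv⟩ := hF e he f hf
      rw [mem_inter] at hv
      have hvj : v ≠ j := fun h => hjf (h ▸ hv.2)
      exact ⟨v, by simp only [mem_inter, mem_insert, mem_erase]; tauto⟩
  intro e' he' f' hf'
  obtain ⟨e, he, rfl⟩ := mem_image.1 he'
  obtain ⟨f, hf, rfl⟩ := mem_image.1 hf'
  unfold shiftEdge
  split_ifs with h1 h2 h2
  · exact ⟨i, by simp⟩
  · exact hone e he f hf h1 h2
  · rw [inter_comm]
    exact hone f hf e he h2 h1
  · exact hF e he f hf

theorem mem_shift_of_not_moved {e : Finset α} (he : e ∈ F)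
    (h : ¬ (j ∈ e ∧ i ∉ e ∧ insert i (e.erase j) ∉ F)) : e ∈ shift i j F :=
  mem_image.2 ⟨e, he, if_neg h⟩

/-- If a shift turns a family that is not a star into a star, then the new centre is `i`; hence
the edges of the family meet `{i, j}`, and its links of `i` and `j` are disjoint. -/
theorem of_shift_star (hij : i ≠ j) {v : α} (hv : ∀ e ∈ shift i j F, v ∈ e)
    (hstar : ∃ e ∈ F, v ∉ e) :
    (∀ e ∈ F, i ∈ e ∨ j ∈ e) ∧ Disjoint (linkAvoiding i j F) (linkAvoiding j i F) := by
  have hv' : ∀ e ∈ F, v ∈ shiftEdge i j F e := fun e he => hv _ (mem_image_of_mem _ he)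
  obtain ⟨e, he, hve⟩ := hstar
  obtain rfl : v = i := by
    by_contra hvi
    have h := hv' e he
    by_cases hvj : v = j
    · subst hvj
      unfold shiftEdge at h
      split_ifs at h with h1
      · exact hve h1.1
      · exact hve h
    · exact hve ((mem_shiftEdge_of_ne hvi hvj).1 h)
  refine ⟨fun f hf => ?_, disjoint_left.2 fun f hf hf' => ?_⟩
  · have h := hv' f hf
    unfold shiftEdge at h
    split_ifs at h with h1
    · exact Or.inr h1.1
    · exact Or.inl h
  · rw [mem_linkAvoiding hij] at hf
    rw [mem_linkAvoiding hij.symm] at hf'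
    have h := hv _ (mem_shift_of_not_moved hf'.2.2 fun h => h.2.2 (by
      rw [erase_insert hf'.1]
      exact hf.2.2))
    rw [mem_insert] at h
    exact h.elim hij hf.1

end Shift

theorem sum_shift_lt {i j : ℕ} (hij : i < j) {F : Finset (Finset ℕ)}
    (hF : ¬ IsShiftStable i j F) :
    ∑ e ∈ shift i j F, ∑ v ∈ e, v < ∑ e ∈ F, ∑ v ∈ e, v := by
  have hle : ∀ e : Finset ℕ, j ∈ e → i ∉ e → ∑ v ∈ insert i (e.erase j), v < ∑ v ∈ e, v := by
    intro e hj hi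
    rw [sum_insert fun h => hi (mem_of_mem_erase h), ← add_sum_erase e (fun v => v) hj]
    omega
  unfold IsShiftStable at hF
  push Not at hF
  obtain ⟨e, he, hj, hi, hne⟩ := hF
  rw [shift, sum_image shiftEdge_injOn]
  refine sum_lt_sum (fun f _ => ?_) ⟨e, he, ?_⟩
  · unfold shiftEdge
    split_ifs with h
    · exact (hle f h.1 h.2.1).le
    · rfl
  · rw [shiftEdge, if_pos ⟨hj, hi, hne⟩]
    exact hle e hj hi

/-- In a shifted family, some vertices of an edge may be exchanged for as many others, each of
which comes before all the vertices that are removed. -/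
theorem mem_of_shifted {F : Finset (Finset ℕ)} (hF : ∀ i j, i < j → IsShiftStable i j F)
    {e f : Finset ℕ} (he : e ∈ F) (hcard : #f = #e)
    (h : ∀ i ∈ f, i ∉ e → ∀ j ∈ e, j ∉ f → i < j) : f ∈ F := by
  induction hm : #(f \ e) generalizing e with
  | zero =>
    rw [card_eq_zero, sdiff_eq_empty_iff_subset] at hm
    rwa [eq_of_subset_of_card_le hm hcard.ge]
  | succ m ih =>
    have hm' : #(e \ f) = m + 1 := by
      have h1 := card_sdiff_add_card_inter e f
      have h2 := card_sdiff_add_card_inter f e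
      rw [inter_comm] at h2
      omega
    obtain ⟨i, hi⟩ : (f \ e).Nonempty := card_pos.1 (by omega)
    obtain ⟨j, hj⟩ : (e \ f).Nonempty := card_pos.1 (by omega)
    rw [mem_sdiff] at hi hj
    have hij := h i hi.1 hi.2 j hj.1 hj.2
    refine ih (hF i j hij e he hj.1 hi.2) ?_ ?_ ?_
    · rw [card_insert_of_notMem fun h => hi.2 (mem_of_mem_erase h), card_erase_of_mem hj.1]
      have := card_pos.2 ⟨j, hj.1⟩
      omega
    · intro i' hi' hie' j' hj' hjf'
      simp only [mem_insert, mem_erase, not_or, not_and] at hie' hj'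
      have hj'i : j' ≠ i := fun h => hjf' (h ▸ hi.1)
      have hi'j : i' ≠ j := fun h => hj.2 (h ▸ hi')
      exact h i' hi' (hie'.2 hi'j) j' (hj'.resolve_left hj'i).2 hjf'
    · have : f \ insert i (e.erase j) = (f \ e).erase i := by
        ext v
        simp only [mem_sdiff, mem_insert, mem_erase, not_or, not_and]
        constructor
        · rintro ⟨h1, h2, h3⟩
          exact ⟨h2, h1, h3 fun h => hj.2 (h ▸ h1)⟩
        · rintro ⟨h1, h2, h3⟩
          exact ⟨h2, h1, fun _ => h3⟩
      rw [this, card_erase_of_mem (mem_sdiff.2 hi), hm]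
      rfl

/-! ### Families that are not stars -/

/-- If all triples in a four-element set `T` lie in the link of `q`, then the edges in the link of
`p` have at least two vertices in `T`. -/
theorem weight_linkAvoiding_le_of_triples {α : Type*} [DecidableEq α] {x : α → ℝ}
    (hx : ∀ i, 0 ≤ x i) {F : Finset (Finset α)}
    {U T : Finset α} (hU : ∀ e ∈ F, e ⊆ U) (hk : ∀ e ∈ F, #e = 4)
    (hF : ∀ e ∈ F, ∀ f ∈ F, (e ∩ f).Nonempty) {p q : α} (hpq : p ≠ q) (hT : #T = 4)
    (hTU : T ⊆ U \ {p, q}) (htriples : ∀ S ⊆ T, #S = 3 → insert q S ∈ F) :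
    weight (linkAvoiding p q F) x ≤ 0.08 * (∑ v ∈ U \ {p, q}, x v) ^ 3 := by
  refine weight_le_of_two_le_card_inter hx (subset_of_mem_linkAvoiding hpq hU)
    (card_of_mem_linkAvoiding hpq hk) hTU hT fun e he => ?_
  rw [mem_linkAvoiding hpq] at he
  by_contra hlt
  have hcard := card_sdiff_add_card_inter T e
  rw [inter_comm] at hcard
  obtain ⟨S, hS, hS3⟩ := exists_subset_card_eq (show 3 ≤ #(T \ e) by omega)
  obtain ⟨v, hv⟩ := hF _ he.2.2 _ (htriples S (hS.trans sdiff_subset) hS3)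
  simp only [mem_inter, mem_insert] at hv
  have hpT : ∀ w ∈ S, w ≠ p := fun w hw h => by
    have := hTU (mem_sdiff.1 (hS hw)).1
    simp [h] at this
  rcases hv with ⟨hvp | hve, hvq | hvS⟩
  · exact hpq (hvp.symm.trans hvq)
  · exact hpT v hvS hvp
  · exact he.2.1 (hvq ▸ hve)
  · exact (mem_sdiff.1 (hS hvS)).2 hve

theorem weight_lt_of_shifted {N : ℕ} (hN : 6 ≤ N) {x : ℕ → ℝ} (hx : ∀ i, 0 ≤ x i)
    (hsum : ∑ i ∈ range N, x i = 1) {F : Finset (Finset ℕ)} (hU : ∀ e ∈ F, e ⊆ range N)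
    (hk : ∀ e ∈ F, #e = 4) (hF : ∀ e ∈ F, ∀ f ∈ F, (e ∩ f).Nonempty)
    (hshift : ∀ i j, i < j → IsShiftStable i j F) (hstar : ∃ e ∈ F, 0 ∉ e) :
    weight F x < 0.0169 := by
  by_cases hcov : ∀ e ∈ F, 0 ∈ e ∨ 1 ∈ e
  · have h0 : 0 ∈ range N := mem_range.2 (by omega)
    have h1 : 1 ∈ range N := mem_range.2 (by omega)
    have h2 : 2 ∈ range N \ {0, 1} := by simp; omega
    have hc : 0 ≤ (∑ v ∈ range N \ {0, 1}, x v) ^ 3 := pow_nonneg (sum_nonneg fun v _ => hx v) 3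
    refine weight_lt_of_pair_cover hx hU hsum hk zero_ne_one h0 h1 hcov ?_
    by_cases hB : ∀ e ∈ F, 0 ∉ e → 2 ∈ e
    · have hA := weight_linkAvoiding_le hx hU hk hF zero_ne_one hcov hstar
      have hB' := weight_le_of_forall_mem (v := 2) hx
        (subset_of_mem_linkAvoiding one_ne_zero hU) (card_of_mem_linkAvoiding one_ne_zero hk)
        (by rwa [pair_comm]) fun e he => by
          rw [mem_linkAvoiding one_ne_zero] at he
          have := hB _ he.2.2 (by simp [he.2.1])
          simpa using this
      rw [pair_comm] at hB'
      nlinarith [mul_le_mul_of_nonneg_left hA (hx 0), mul_le_mul_of_nonneg_left hB' (hx 1)]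
    · push Not at hB
      obtain ⟨e, he, he0, he2⟩ := hB
      have he1 : 1 ∈ e := (hcov e he).resolve_left he0
      have hmem : ({1, 3, 4, 5} : Finset ℕ) ∈ F := by
        refine mem_of_shifted hshift he (by rw [hk e he]; rfl) fun i hi hie j hj hjf => ?_
        simp only [mem_insert, mem_singleton, not_or] at hi hjf
        have hi1 : i ≠ 1 := fun h => hie (h ▸ he1)
        have hj0 : j ≠ 0 := fun h => he0 (h ▸ hj)
        have hj2 : j ≠ 2 := fun h => he2 (h ▸ hj)
        omega
      have hone : ∀ S ⊆ Ico 2 6, #S = 3 → insert 1 S ∈ F := by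
        intro S hS hS3
        have h1S : 1 ∉ S := fun h => by simpa using hS h
        refine mem_of_shifted hshift hmem (by rw [card_insert_of_notMem h1S, hS3]; rfl)
          fun i hi hie j hj hjf => ?_
        simp only [mem_insert, mem_singleton, not_or] at hi hie hj hjf
        have := mem_Ico.1 (hS (hi.resolve_left hie.1))
        omega
      have hzero : ∀ S ⊆ Ico 2 6, #S = 3 → insert 0 S ∈ F := by
        intro S hS hS3
        have h1S : 1 ∉ S := fun h => by simpa using hS h
        have h0S : 0 ∉ S := fun h => by simpa using hS h
        have := hshift 0 1 one_pos _ (hone S hS hS3) (mem_insert_self _ _) (by simp [h0S])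
        rwa [erase_insert h1S] at this
      have hT : Ico 2 6 ⊆ range N \ {0, 1} := by
        intro v hv
        rw [mem_Ico] at hv
        simp
        omega
      have hA := weight_linkAvoiding_le_of_triples hx hU hk hF zero_ne_one rfl hT hone
      have hB := weight_linkAvoiding_le_of_triples hx hU hk hF one_ne_zero rfl
        (by rwa [pair_comm]) hzero
      rw [pair_comm] at hB
      nlinarith [mul_le_mul_of_nonneg_left hA (hx 0), mul_le_mul_of_nonneg_left hB (hx 1),
        mul_nonneg (hx 0) hc]
  · push Not at hcov
    obtain ⟨e, he, he0, he1⟩ := hcov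
    have hmem : Ico 2 6 ∈ F := by
      refine mem_of_shifted hshift he (by rw [hk e he]; rfl) fun i hi hie j hj hjf => ?_
      rw [mem_Ico] at hi hjf
      have hj0 : j ≠ 0 := fun h => he0 (h ▸ hj)
      have hj1 : j ≠ 1 := fun h => he1 (h ▸ hj)
      omega
    have hall : ∀ f ⊆ range 6, #f = 4 → f ∈ F := by
      intro f hf hf4
      refine mem_of_shifted hshift hmem (by rw [hf4]; rfl) fun i hi hie j hj hjf => ?_
      have := mem_range.1 (hf hi)
      rw [mem_Ico] at hie hj
      omega
    have h := weight_le_of_three_le_card_inter (T := range 6) hx hU hsum hk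
      (range_subset_range.2 hN) rfl fun f hf => by
        by_contra hlt
        have hcard := card_sdiff_add_card_inter (range 6) f
        rw [inter_comm, card_range] at hcard
        obtain ⟨S, hS, hS4⟩ := exists_subset_card_eq (show 4 ≤ #(range 6 \ f) by omega)
        obtain ⟨v, hv⟩ := hF f hf S (hall S (hS.trans sdiff_subset) hS4)
        rw [mem_inter] at hv
        exact (mem_sdiff.1 (hS hv.2)).2 hv.1
    norm_num at h ⊢
    linarith

/-- Shifting towards the heavier vertices does not decrease the weight; it stops at a shifted
family, or just before the family becomes a star. -/
theorem weight_lt_of_antitone {N : ℕ} (hN : 6 ≤ N) {x : ℕ → ℝ} (hx : ∀ i, 0 ≤ x i)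
    (hanti : Antitone x) (hsum : ∑ i ∈ range N, x i = 1) {F : Finset (Finset ℕ)}
    (hU : ∀ e ∈ F, e ⊆ range N) (hk : ∀ e ∈ F, #e = 4)
    (hF : ∀ e ∈ F, ∀ f ∈ F, (e ∩ f).Nonempty) (hstar : ∀ v, ∃ e ∈ F, v ∉ e) :
    weight F x < 0.0169 := by
  induction hm : ∑ e ∈ F, ∑ v ∈ e, v using Nat.strong_induction_on generalizing F with
  | _ m ih =>
    subst hm
    by_cases hshift : ∀ i j, i < j → IsShiftStable i j F
    · exact weight_lt_of_shifted hN hx hsum hU hk hF hshift (hstar 0)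
    push Not at hshift
    obtain ⟨i, j, hij, hns⟩ := hshift
    have hjN : j ∈ range N := by
      unfold IsShiftStable at hns
      push Not at hns
      obtain ⟨e, he, hj, -⟩ := hns
      exact hU e he hj
    have hiN : i ∈ range N := mem_range.2 (hij.trans (mem_range.1 hjN))
    by_cases hs : ∃ v, ∀ e ∈ shift i j F, v ∈ e
    · obtain ⟨v, hv⟩ := hs
      obtain ⟨hcov, hdisj⟩ := of_shift_star hij.ne hv (hstar v)
      exact weight_lt_of_disjoint_links hx hU hsum hk hF hij.ne hiN hjN (hanti hij.le) hcov
        (hstar i) hdisj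
    · push Not at hs
      refine (weight_le_weight_shift hx (hanti hij.le)).trans_lt
        (ih _ (sum_shift_lt hij hns) ?_ ?_ (shift_intersecting hF) hs rfl) <;>
      · intro e' he'
        obtain ⟨e, he, rfl⟩ := mem_image.1 he'
        first
          | exact shiftEdge_subset hiN (hU e he)
          | rw [card_shiftEdge, hk e he]

/-- The antitone case, transported along an enumeration of the vertices by decreasing weight.
Vertices of weight `0` are appended, so that there are at least six. -/
theorem weight_lt_of_not_star {n : ℕ} {x : Fin n → ℝ} (hx : ∀ i, 0 ≤ x i)
    (hsum : ∑ i, x i = 1) {F : Finset (Finset (Fin n))} (hk : ∀ e ∈ F, #e = 4)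
    (hF : ∀ e ∈ F, ∀ f ∈ F, (e ∩ f).Nonempty) (hne : F.Nonempty)
    (hstar : ∀ v, ∃ e ∈ F, v ∉ e) : weight F x < 0.0169 := by
  set σ : Equiv.Perm (Fin n) := Tuple.sort fun i => -x i with hσ
  have hmono : Monotone ((fun i => -x i) ∘ σ) := Tuple.monotone_sort _
  -- `σ i` is the `i`-th heaviest vertex, and `ι` maps each vertex to its rank.
  let ι : Fin n ↪ ℕ := (σ.symm.toEmbedding).trans Fin.valEmbedding
  let y : ℕ → ℝ := fun i => if h : i < n then x (σ ⟨i, h⟩) else 0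
  have hιn : ∀ v, ι v < n := fun v => (σ.symm v).2
  have hyι : ∀ v, y (ι v) = x v := fun v => by
    have : σ ⟨ι v, hιn v⟩ = v := σ.apply_symm_apply v
    simp only [y, dif_pos (hιn v), this]
  have hy : ∀ i, 0 ≤ y i := fun i => by
    simp only [y]
    split_ifs
    exacts [hx _, le_rfl]
  have hanti : Antitone y := by
    intro i j hij
    by_cases hj : j < n
    · have := hmono (show (⟨i, hij.trans_lt hj⟩ : Fin n) ≤ ⟨j, hj⟩ from hij)
      simp only [Function.comp_apply, neg_le_neg_iff] at this
      simpa only [y, dif_pos hj, dif_pos (hij.trans_lt hj)] using this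
    · simp only [y, dif_neg hj]
      exact hy i
  have hysum : ∑ i ∈ range (n + 6), y i = 1 := by
    rw [← hsum, ← sum_subset (s₁ := univ.map ι)]
    · rw [sum_map]
      exact sum_congr rfl fun v _ => hyι v
    · intro i hi
      obtain ⟨v, -, rfl⟩ := mem_map.1 hi
      exact mem_range.2 ((hιn v).trans_le (Nat.le_add_right n 6))
    · intro i _ hi
      refine dif_neg fun h => hi (mem_map.2 ⟨σ ⟨i, h⟩, mem_univ _, ?_⟩)
      simp [ι]
  have hweight : weight (F.map (mapEmbedding ι).toEmbedding) y = weight F x := by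
    rw [weight, weight, sum_map]
    refine sum_congr rfl fun e _ => ?_
    simp only [RelEmbedding.coe_toEmbedding, mapEmbedding_apply, prod_map]
    exact prod_congr rfl fun v _ => hyι v
  rw [← hweight]
  refine weight_lt_of_antitone (Nat.le_add_left 6 n) hy hanti hysum ?_ ?_ ?_ ?_
  · intro e' he' i hi
    obtain ⟨e, he, rfl⟩ := mem_map.1 he'
    obtain ⟨v, -, rfl⟩ := mem_map.1 hi
    exact mem_range.2 ((hιn v).trans_le (Nat.le_add_right n 6))
  · intro e' he'
    obtain ⟨e, he, rfl⟩ := mem_map.1 he'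
    simp [hk e he]
  · intro e' he' f' hf'
    obtain ⟨e, he, rfl⟩ := mem_map.1 he'
    obtain ⟨f, hf, rfl⟩ := mem_map.1 hf'
    simpa [← map_inter] using hF e he f hf
  · intro i
    by_cases hi : ∃ v, ι v = i
    · obtain ⟨v, rfl⟩ := hi
      obtain ⟨e, he, hve⟩ := hstar v
      exact ⟨e.map ι, mem_map.2 ⟨e, he, rfl⟩, by simpa using hve⟩
    · obtain ⟨e, he⟩ := hne
      refine ⟨e.map ι, mem_map.2 ⟨e, he, rfl⟩, fun h => hi ?_⟩
      obtain ⟨v, -, hv⟩ := mem_map.1 h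
      exact ⟨v, hv⟩

/-! ### Stars -/

theorem weight_le_of_star {n : ℕ} {x : Fin n → ℝ} (hx : ∀ i, 0 ≤ x i)
    (hsum : ∑ i, x i = 1) {F : Finset (Finset (Fin n))} (hk : ∀ e ∈ F, #e = 4) (hn : 2 ≤ n)
    {v : Fin n} (hv : ∀ e ∈ F, v ∈ e) :
    weight F x ≤ 9 * ((n : ℝ) - 2) * ((n : ℝ) - 3) / (512 * ((n : ℝ) - 1) ^ 2) := by
  have h := weight_le_sum_esymm_mul_esymm hx (U := univ) {v} {1} (fun e _ => subset_univ e) hk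
    fun e he => by simp [inter_singleton_of_mem (hv e he)]
  have hcard : #(univ \ {v} : Finset (Fin n)) = n - 1 := by
    rw [card_sdiff_of_subset (subset_univ _), card_singleton, card_univ, Fintype.card_fin]
  have h3 := esymm_le_choose_mul_pow_of_card_eq hx 3 hcard
  have hs := sum_sdiff (f := x) (subset_univ {v})
  rw [sum_singleton, hsum] at hs
  simp only [sum_singleton, esymm_one, Nat.reduceSub] at h
  obtain ⟨m, rfl⟩ : ∃ m, n = m + 2 := ⟨n - 2, by omega⟩
  set s := ∑ i ∈ univ \ {v}, x i
  have hs0 : 0 ≤ s := sum_nonneg fun i _ => hx i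
  have hv0 := hx v
  have hchoose : (((m + 2 - 1).choose 3 : ℕ) : ℝ) * 6 = (m + 1) * m * (m - 1) := by
    have h1 := Nat.descFactorial_eq_factorial_mul_choose (m + 1) 3
    have h2 : (((m + 1).descFactorial 3 : ℕ) : ℝ) = (m + 1) * m * (m - 1) := by
      cases m <;> simp [Nat.descFactorial] ; ring
    rw [← h2, h1]
    simp [Nat.factorial]
    ring
  have hxv : x v = 1 - s := by linarith
  -- The arithmetic-geometric mean inequality, with equality at `s = 3 / 4`.
  have hamgm : x v * s ^ 3 ≤ 27 / 256 := by
    have : 0 ≤ (4 * s - 3) ^ 2 * (16 * s ^ 2 + 8 * s + 3) := by positivity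
    rw [hxv]
    nlinarith [this]
  have hm : ((m + 2 - 1 : ℕ) : ℝ) = m + 1 := by push_cast; simp
  have hm1 : (0 : ℝ) < m + 1 := by positivity
  calc weight F x ≤ x v * esymm 3 (univ \ {v}) x := h
    _ ≤ x v * (((m + 2 - 1).choose 3 : ℕ) * (s / ((m + 2 - 1 : ℕ) : ℝ)) ^ 3) :=
        mul_le_mul_of_nonneg_left h3 hv0
    _ = (x v * s ^ 3) * ((((m + 2 - 1).choose 3 : ℕ) : ℝ) / (m + 1) ^ 3) := by
        rw [hm, div_pow]
        ring
    _ ≤ 27 / 256 * ((((m + 2 - 1).choose 3 : ℕ) : ℝ) / (m + 1) ^ 3) :=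
        mul_le_mul_of_nonneg_right hamgm (by positivity)
    _ = _ := by
        have : (((m + 2 - 1).choose 3 : ℕ) : ℝ) = (m + 1) * m * (m - 1) / 6 := by linarith
        rw [this]
        push_cast
        have h1 : (m : ℝ) + 2 - 1 = m + 1 := by ring
        rw [h1]
        field_simp
        ring

/-! ### Matchings and stars as hypergraphs -/

/-- Two disjoint edges span a copy of the matching `M_2^r`. -/
theorem inter_nonempty_of_free_matching {r : ℕ} {V : Type*} [DecidableEq V] {F : RGraph r V}
    (hF : (RGraph.matching 2 r).Free F) : ∀ e ∈ F.edges, ∀ f ∈ F.edges, (e ∩ f).Nonempty := by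
  intro e he f hf
  by_contra hne
  rw [not_nonempty_iff_eq_empty, ← disjoint_iff_inter_eq_empty] at hne
  apply hF
  let φ : Fin 2 → Finset V := ![e, f]
  have hφ : ∀ i, φ i ∈ F.edges := by
    intro i
    fin_cases i
    exacts [he, hf]
  let ψ : ∀ i, Fin r ≃ φ i := fun i => ((φ i).equivFinOfCardEq (F.uniform _ (hφ i))).symm
  have hdisj : ∀ i j, ∀ v, v ∈ φ i → v ∈ φ j → i = j := by
    intro i j v hi hj
    fin_cases i <;> fin_cases j
    · rfl
    · exact absurd hj (disjoint_left.1 hne hi)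
    · exact absurd hi (disjoint_left.1 hne hj)
    · rfl
  have hinj : Function.Injective fun p : Fin 2 × Fin r => (ψ p.1 p.2 : V) := by
    rintro ⟨i, k⟩ ⟨j, l⟩ h
    obtain rfl : i = j := hdisj i j _ (ψ i k).2 (by
      have h' : (ψ i k : V) = ψ j l := h
      rw [h']
      exact (ψ j l).2)
    exact Prod.ext rfl ((ψ i).injective (Subtype.ext h))
  refine ⟨⟨_, hinj⟩, fun d hd => ?_⟩
  obtain ⟨i, -, rfl⟩ := mem_image.1 hd
  convert hφ i using 1
  ext v
  simp only [mem_map, mem_product, mem_singleton, mem_univ, and_true, Function.Embedding.coeFn_mk]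
  constructor
  · rintro ⟨⟨j, l⟩, rfl, rfl⟩
    exact (ψ j l).2
  · intro hv
    exact ⟨(i, (ψ i).symm ⟨v, hv⟩), rfl, by simp⟩

theorem isSubgraph_star_iff {r n : ℕ} {F : RGraph r (Fin n)} {v : Fin n} :
    F.IsSubgraph (RGraph.star r v) ↔ ∀ e ∈ F.edges, v ∈ e := by
  refine ⟨fun h e he => (mem_filter.1 (h he)).2, fun h e he => ?_⟩
  exact mem_filter.2 ⟨mem_powersetCard.2 ⟨subset_univ e, F.uniform e he⟩, h e he⟩

end IntersectingLagrangian

open IntersectingLagrangian in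
theorem theorem1p3 (n : ℕ) (hn : 2 ≤ n) (F : RGraph 4 (Fin n))
    (hF : (RGraph.matching 2 4).Free F) :
    ((¬ ∃ v : Fin n, F.IsSubgraph (RGraph.star 4 v)) →
      F.lagrangian < 0.0169 ∧ (0.0169 : ℝ) < 9 / 512) ∧
    ((∃ v : Fin n, F.IsSubgraph (RGraph.star 4 v)) →
      F.lagrangian ≤ 9 * ((n : ℝ) - 2) * ((n : ℝ) - 3) / (512 * ((n : ℝ) - 1) ^ 2)) := by
  have : Nonempty (Fin n) := ⟨⟨0, by omega⟩⟩
  obtain ⟨⟨x, hx, hmax⟩, -⟩ := F.isGreatest_lagrangian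
  rw [← hmax]
  simp only [isSubgraph_star_iff]
  constructor
  · intro hstar
    push Not at hstar
    obtain ⟨e, he, -⟩ := hstar (Classical.arbitrary _)
    exact ⟨weight_lt_of_not_star hx.1 hx.2 F.uniform (inter_nonempty_of_free_matching hF)
      ⟨e, he⟩ hstar, by norm_num⟩
  · rintro ⟨v, hv⟩
    exact weight_le_of_star hx.1 hx.2 F.uniform hn hv
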